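/- Let $\mathcal{C}$ be a small category and $\Lambda$ a commutative unital ring. Let $\mathbf{U}\mathcal{C}$ be the category of presheaves on $\mathcal{C}$ with values in unbounded ($\mathbb{Z}$-graded) chain complexes of $\Lambda$-modules. A morphism of $\mathbf{U}\mathcal{C}$ is called a weak equivalence (respectively a fibration) if its value at every object of $\mathcal{C}$ is a quasi-isomorphism (respectively surjective in each degree); it is a trivial fibration if it is both, and a projective cofibration if it has the left lifting property with respect to all trivial fibrations. An object $K$ is projective cofibrant if $0\to K$ is a projective cofibration. For $c\in\mathcal{C}$ let $\Lambda(c)$ be the representable presheaf of $\Lambda$-modules $d\mapsto\Lambda[\operatorname{Hom}_{\mathcal{C}}(d,c)]$ (free $\Lambda$-module). A presheaf of $\Lambda$-modules is called semi-representable if it is isomorphic to a small coproduct of representables $\Lambda(c)$. Then there exists an endofunctor $Q:\mathbf{U}\mathcal{C}\to\mathbf{U}\mathcal{C}$ together with a natural transformation $Q\to\mathrm{id}$ such that: 1. for every $K\in\mathbf{U}\mathcal{C}$, the component $Q(K)\to K$ is a trivial fibration; 2. for every $K\in\mathbf{U}\mathcal{C}$, the object $Q(K)$ is projective cofibrant,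 and for each $n\in\mathbb{Z}$ the presheaf of $\Lambda$-modules $Q(K)_n$ is semi-representable. In particular, $Q$ is a cofibrant replacement functor, i.e. an endofunctor with projective cofibrant values, equipped with a natural transformation $Q\to\mathrm{id}$ whose components are trivial fibrations. -/

import Mathlib

open CategoryTheory CategoryTheory.Limits Opposite HomotopicalAlgebra

universe u

/-- The category of presheaves on `C` with values in unbounded complexes of `Λ`-modules
(homologically indexed by `ℤ`). -/
abbrev ComplexPresheaf (C : Type u) [SmallCategory C] (Λ : Type u) [CommRing Λ] :
    Type (u + 1) :=
  Cᵒᵖ ⥤ ChainComplex (ModuleCat.{u} Λ) ℤ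

namespace ComplexPresheaf

variable {C : Type u} [SmallCategory C] {Λ : Type u} [CommRing Λ]

/-- The presheaf of `Λ`-modules in degree `n` of a presheaf of complexes. -/
abbrev degree (K : ComplexPresheaf C Λ) (n : ℤ) : Cᵒᵖ ⥤ ModuleCat.{u} Λ :=
  K ⋙ HomologicalComplex.eval (ModuleCat.{u} Λ) (ComplexShape.down ℤ) n

/-- Projective fibrations: the morphisms that are surjective on every object, in every degree. -/
instance : CategoryWithFibrations (ComplexPresheaf C Λ) where
  fibrations := fun _ _ f =>
    ∀ (c : Cᵒᵖ) (n : ℤ), Function.Surjective ((f.app c).f n)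

/-- Weak equivalences: the morphisms that are quasi-isomorphisms on every object. -/
instance : CategoryWithWeakEquivalences (ComplexPresheaf C Λ) where
  weakEquivalences := fun _ _ f => ∀ c : Cᵒᵖ, QuasiIso (f.app c)

/-- Projective cofibrations: the morphisms with the left lifting property with respect to
all trivial fibrations. -/
instance : CategoryWithCofibrations (ComplexPresheaf C Λ) where
  cofibrations := (trivialFibrations (ComplexPresheaf C Λ)).llp

end ComplexPresheaf

section

variable {C : Type u} [SmallCategory C] (Λ : Type u) [CommRing Λ]

/-- The representable presheaf of `Λ`-modules `Λ(c)`, sending `d` to the free `Λ`-module on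
`Hom(d, c)`. -/
noncomputable def representablePresheaf (c : C) : Cᵒᵖ ⥤ ModuleCat.{u} Λ :=
  yoneda.obj c ⋙ ModuleCat.free Λ

variable {Λ}

/-- A presheaf of `Λ`-modules is semi-representable if it is (isomorphic to) a small coproduct
of representables. -/
def IsSemiRepresentable (F : Cᵒᵖ ⥤ ModuleCat.{u} Λ) : Prop :=
  ∃ (I : Type u) (x : I → C), Nonempty (F ≅ ∐ fun i => representablePresheaf Λ (x i))

/-- A complex of semi-representables. -/
def ComplexPresheaf.IsComplexOfSemiRepresentables (K : ComplexPresheaf C Λ) : Prop :=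
  ∀ n : ℤ, IsSemiRepresentable (K.degree n)

end

/-- A cofibrant replacement functor: an endofunctor with cofibrant values together with a natural
transformation to the identity whose components are trivial fibrations. -/
def IsCofibrantReplacementFunctor {M : Type*} [Category* M] [HasInitial M]
    [CategoryWithFibrations M] [CategoryWithCofibrations M] [CategoryWithWeakEquivalences M]
    (Q : M ⥤ M) (q : Q ⟶ 𝟭 M) : Prop :=
  ∀ X : M, IsCofibrant (Q.obj X) ∧ trivialFibrations M (q.app X)

/-!
The cofibrant replacement `Q K` is freely generated by cells. A cell of degree `n` over an
object `c` consists of a cycle `z` of `Q K` in degree `n - 1` over `c` (its boundary), written as a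
finite linear combination of restrictions of cells of degree `n - 1`, and a section `y` of `K` in
degree `n` over `c` (its value) whose boundary is the image of `z` in `K`. This recursive
description plays the role of the small object argument, without any colimit: the formal cells
form the inductive type `ComplexPresheaf.PreCell`, in which the linear combination and `y` are
unrelated, and the cells `ComplexPresheaf.Cell` are the formal cells satisfying the
conditions hereditarily (`PreCell.Valid`). A cycle may have several presentations as a linear
combination, which give different cells; this redundancy is harmless. The construction is
functorial, because a morphism of presheaves of complexes only changes the values. In each degree
`Q K` is a free presheaf on a family of sets, hence a coproduct of
representables (`freePresheaf.isColimit`).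

A morphism of complexes `p : K ⟶ L` is a surjective quasi-isomorphism if and only if, for all
cycles `z` of `K` and all `y` in `L` whose boundary is `p z`, there is `x` in `K` with boundary `z`
and image `y` (`ChainComplex.LiftsDisks`). For `Q K ⟶ K` such an `x` is provided by the cell
with boundary `z` and value `y` (`Cell.exists_boundary_eq`), so that `Q K ⟶ K` is a trivial
fibration. For the same reason `Q K` is cofibrant: a morphism from `Q K` is lifted along a trivial
fibration cell by cell, by recursion on the cells (`Cell.liftAux_spec`).
-/

/-! ### Surjective quasi-isomorphisms, elementwise -/

namespace ChainComplex

variable {R : Type u} [CommRing R] {K L : ChainComplex (ModuleCat.{u} R) ℤ}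

lemma exists_iCycles_eq (K : ChainComplex (ModuleCat.{u} R) ℤ) {i j : ℤ} (h : j + 1 = i)
    (x : K.X i) (hx : K.d i j x = 0) : ∃ z : K.cycles i, K.iCycles i z = x :=
  (ShortComplex.moduleCat_exact_iff _).1
    (ShortComplex.exact_of_f_is_kernel (ShortComplex.mk _ _ (K.iCycles_d i j))
      (K.cyclesIsKernel i j ((ComplexShape.down ℤ).next_eq' h))) x hx

lemma homologyπ_eq_zero_iff (K : ChainComplex (ModuleCat.{u} R) ℤ) {i j : ℤ} (h : j + 1 = i)
    (z : K.cycles j) : K.homologyπ j z = 0 ↔ ∃ x : K.X i, K.d i j x = K.iCycles j z := by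
  have hinj : Function.Injective (K.iCycles j) := (ModuleCat.mono_iff_injective _).1 inferInstance
  constructor
  · intro hz
    obtain ⟨x, hx⟩ := (ShortComplex.moduleCat_exact_iff _).1
      (ShortComplex.exact_of_g_is_cokernel (ShortComplex.mk _ _ (K.toCycles_comp_homologyπ i j))
        (K.homologyIsCokernel i j ((ComplexShape.down ℤ).prev_eq' h))) z hz
    refine ⟨x, ?_⟩
    rw [← hx]
    exact (ConcreteCategory.congr_hom (K.toCycles_i i j) x).symm
  · rintro ⟨x, hx⟩
    have : z = K.toCycles i j x :=
      hinj (hx.symm.trans (ConcreteCategory.congr_hom (K.toCycles_i i j) x).symm)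
    rw [this]
    exact ConcreteCategory.congr_hom (K.toCycles_comp_homologyπ i j) x

lemma homologyπ_surjective (K : ChainComplex (ModuleCat.{u} R) ℤ) (j : ℤ) :
    Function.Surjective (K.homologyπ j) :=
  (ModuleCat.epi_iff_surjective _).1 inferInstance

lemma d_iCycles_apply (K : ChainComplex (ModuleCat.{u} R) ℤ) (i j : ℤ) (z : K.cycles i) :
    K.d i j (K.iCycles i z) = 0 :=
  ConcreteCategory.congr_hom (K.iCycles_d i j) z

lemma comm_apply (p : K ⟶ L) (i j : ℤ) (x : K.X i) :
    L.d i j (p.f i x) = p.f j (K.d i j x) :=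
  ConcreteCategory.congr_hom (p.comm i j) x

lemma d_d_apply (K : ChainComplex (ModuleCat.{u} R) ℤ) (i j k : ℤ) (x : K.X i) :
    K.d j k (K.d i j x) = 0 :=
  ConcreteCategory.congr_hom (K.d_comp_d i j k) x

lemma iCycles_cyclesMap_apply (p : K ⟶ L) (i : ℤ) (z : K.cycles i) :
    L.iCycles i (HomologicalComplex.cyclesMap p i z) = p.f i (K.iCycles i z) :=
  ConcreteCategory.congr_hom (HomologicalComplex.cyclesMap_i p i) z

lemma homologyMap_π_apply (p : K ⟶ L) (i : ℤ) (z : K.cycles i) :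
    HomologicalComplex.homologyMap p i (K.homologyπ i z) =
      L.homologyπ i (HomologicalComplex.cyclesMap p i z) :=
  ConcreteCategory.congr_hom (HomologicalComplex.homologyπ_naturality p i) z

/-- The elementwise form of the right lifting property against the inclusions of the sphere
`S^j` into the disk `D^i`, where `i = j + 1`. -/
def LiftsDisks (p : K ⟶ L) : Prop :=
  ∀ ⦃i j : ℤ⦄, j + 1 = i → ∀ (z : K.X j) (y : L.X i), (∀ l, l + 1 = j → K.d j l z = 0) →
    p.f j z = L.d i j y → ∃ x : K.X i, K.d i j x = z ∧ p.f i x = y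

lemma liftsDisks_of_quasiIso (p : K ⟶ L) (hp : ∀ n, Function.Surjective (p.f n)) [QuasiIso p] :
    LiftsDisks p := by
  intro i j h z y hz hy
  have hbij (n : ℤ) : Function.Bijective (HomologicalComplex.homologyMap p n) :=
    ConcreteCategory.bijective_of_isIso _
  -- `z` is a boundary, since its image is
  obtain ⟨z, rfl⟩ := K.exists_iCycles_eq (sub_add_cancel j 1) z (hz _ (sub_add_cancel j 1))
  have h0 : K.homologyπ j z = 0 := by
    apply (hbij j).1
    rw [homologyMap_π_apply, map_zero, homologyπ_eq_zero_iff _ h]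
    exact ⟨y, by rw [iCycles_cyclesMap_apply, hy]⟩
  obtain ⟨w, hw⟩ := (K.homologyπ_eq_zero_iff h z).1 h0
  -- the cycle `p w - y` is homologous to the image of a cycle `t`
  obtain ⟨v, hv⟩ := L.exists_iCycles_eq h (p.f i w - y) (by
    rw [map_sub, comm_apply, hw, hy, sub_self])
  obtain ⟨t', ht'⟩ := (hbij i).2 (L.homologyπ i v)
  obtain ⟨t, rfl⟩ := K.homologyπ_surjective i t'
  obtain ⟨s, hs⟩ := (L.homologyπ_eq_zero_iff (i := i + 1) rfl
      (v - HomologicalComplex.cyclesMap p i t)).1 (by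
    rw [map_sub, ← ht', homologyMap_π_apply, sub_self])
  obtain ⟨s, rfl⟩ := hp _ s
  rw [comm_apply, map_sub, hv, iCycles_cyclesMap_apply] at hs
  refine ⟨w - K.iCycles i t - K.d _ _ s, ?_, ?_⟩
  · rw [map_sub, map_sub, hw, d_iCycles_apply, d_d_apply, sub_zero, sub_zero]
  · rw [map_sub, map_sub, hs]
    abel

lemma LiftsDisks.exists_cycle {p : K ⟶ L} (hp : LiftsDisks p) {i j : ℤ} (h : j + 1 = i)
    (y : L.X i) (hy : L.d i j y = 0) : ∃ x : K.X i, K.d i j x = 0 ∧ p.f i x = y :=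
  hp h 0 y (fun _ _ => map_zero _) (by rw [map_zero, hy])

/-- To hit `y`, its boundary is first lifted to a cycle, which is then the boundary of a lift
of `y`. -/
lemma LiftsDisks.surjective {p : K ⟶ L} (hp : LiftsDisks p) (n : ℤ) :
    Function.Surjective (p.f n) := fun y => by
  obtain ⟨z, hz, hz'⟩ := hp.exists_cycle (sub_add_cancel (n - 1) 1) (L.d n (n - 1) y)
    (d_d_apply ..)
  obtain ⟨x, -, hx⟩ := hp (sub_add_cancel n 1) z y
    (fun l hl => by obtain rfl : l = n - 1 - 1 := by omega
                    exact hz) hz'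
  exact ⟨x, hx⟩

lemma LiftsDisks.quasiIso {p : K ⟶ L} (hp : LiftsDisks p) : QuasiIso p where
  quasiIsoAt n := by
    rw [quasiIsoAt_iff_isIso_homologyMap, ConcreteCategory.isIso_iff_bijective]
    constructor
    · rw [injective_iff_map_eq_zero]
      intro a ha
      obtain ⟨z, rfl⟩ := K.homologyπ_surjective n a
      rw [homologyMap_π_apply, homologyπ_eq_zero_iff _ rfl] at ha
      obtain ⟨y, hy⟩ := ha
      obtain ⟨x, hx, -⟩ := hp rfl (K.iCycles n z) y (fun l _ => d_iCycles_apply ..)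
        (by rw [hy, iCycles_cyclesMap_apply])
      exact (K.homologyπ_eq_zero_iff rfl z).2 ⟨x, hx⟩
    · intro a
      obtain ⟨z, rfl⟩ := L.homologyπ_surjective n a
      obtain ⟨x, hx, hx'⟩ := hp.exists_cycle (sub_add_cancel n 1) (L.iCycles n z)
        (d_iCycles_apply ..)
      obtain ⟨t, rfl⟩ := K.exists_iCycles_eq (sub_add_cancel n 1) x hx
      refine ⟨K.homologyπ n t, ?_⟩
      rw [homologyMap_π_apply]
      congr 1
      apply (ModuleCat.mono_iff_injective (L.iCycles n)).1 inferInstance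
      rw [iCycles_cyclesMap_apply, hx']

end ChainComplex

/-! ### Free presheaves of modules -/

variable {C : Type u} [SmallCategory C] {Λ : Type u} [CommRing Λ]

/-- The free presheaf of `Λ`-modules on a family of sets `G` indexed by the objects of `C`, i.e.
the value at `G` of the left adjoint of the forgetful functor from presheaves of modules to
families of sets. Its value at `d` is free on the pairs of a morphism `d ⟶ c` and an element
of `G c`. -/
noncomputable def freePresheaf (Λ : Type u) [CommRing Λ] (G : C → Type u) :
    Cᵒᵖ ⥤ ModuleCat.{u} Λ where
  obj d := ModuleCat.of Λ ((Σ c, (d.unop ⟶ c) × G c) →₀ Λ)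
  map φ := ModuleCat.ofHom (Finsupp.lmapDomain Λ Λ fun s => ⟨s.1, φ.unop ≫ s.2.1, s.2.2⟩)
  map_id d := by
    refine ModuleCat.hom_ext (Finsupp.lhom_ext' fun s => LinearMap.ext_ring ?_)
    exact Finsupp.mapDomain_single.trans (by simp)
  map_comp φ ψ := by
    refine ModuleCat.hom_ext (Finsupp.lhom_ext' fun s => LinearMap.ext_ring ?_)
    refine Finsupp.mapDomain_single.trans (.symm ?_)
    refine (congrArg _ Finsupp.mapDomain_single).trans (Finsupp.mapDomain_single.trans ?_)
    simp

namespace freePresheaf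

variable {G H : C → Type u} {M : Cᵒᵖ ⥤ ModuleCat.{u} Λ}

/-- The restriction along `f : d ⟶ c` of the generator of the free presheaf given by `g : G c`. -/
noncomputable def of {d c : C} (f : d ⟶ c) (g : G c) : (freePresheaf Λ G).obj (op d) :=
  Finsupp.single (⟨c, f, g⟩ : Σ c, (d ⟶ c) × G c) (1 : Λ)

lemma map_of {e d c : C} (φ : e ⟶ d) (f : d ⟶ c) (g : G c) :
    (freePresheaf Λ G).map φ.op (of f g) = of (φ ≫ f) g :=
  Finsupp.mapDomain_single

/-- The morphism out of a free presheaf determined by the images of the generators. -/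
noncomputable def desc (a : ∀ c, G c → M.obj (op c)) : freePresheaf Λ G ⟶ M where
  app d := ModuleCat.ofHom (Finsupp.linearCombination Λ
    fun s : Σ c, (d.unop ⟶ c) × G c => M.map s.2.1.op (a s.1 s.2.2))
  naturality d e φ := by
    refine ModuleCat.hom_ext (Finsupp.lhom_ext' fun s => LinearMap.ext_ring ?_)
    refine (congrArg _ Finsupp.mapDomain_single).trans
      ((Finsupp.linearCombination_single ..).trans (.symm ?_))
    refine (congrArg (M.map φ) (Finsupp.linearCombination_single ..)).trans ?_
    simp

lemma desc_of (a : ∀ c, G c → M.obj (op c)) {d c : C} (f : d ⟶ c) (g : G c) :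
    (desc (Λ := Λ) a).app (op d) (of f g) = M.map f.op (a c g) :=
  (Finsupp.linearCombination_single ..).trans (one_smul _ _)

lemma desc_of_id (a : ∀ c, G c → M.obj (op c)) {c : C} (g : G c) :
    (desc (Λ := Λ) a).app (op c) (of (𝟙 c) g) = a c g := by
  rw [desc_of, op_id, M.map_id, ModuleCat.id_apply]

lemma app_of (α : freePresheaf Λ G ⟶ M) {d c : C} (f : d ⟶ c) (g : G c) :
    α.app (op d) (of f g) = M.map f.op (α.app (op c) (of (𝟙 c) g)) := by
  rw [← NatTrans.naturality_apply, map_of, Category.comp_id]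

lemma hom_ext {α β : freePresheaf Λ G ⟶ M}
    (h : ∀ (c : C) (g : G c), α.app (op c) (of (𝟙 c) g) = β.app (op c) (of (𝟙 c) g)) : α = β := by
  ext d : 2
  refine ModuleCat.hom_ext (Finsupp.lhom_ext' fun ⟨c, f, g⟩ => LinearMap.ext_ring ?_)
  change α.app (op d.unop) (of f g) = β.app (op d.unop) (of f g)
  rw [app_of α, app_of β, h]

lemma exists_eq_sum {d : C} (z : (freePresheaf Λ G).obj (op d)) :
    ∃ (k : ℕ) (coeff : Fin k → Λ) (tgt : Fin k → C) (f : ∀ i, d ⟶ tgt i) (g : ∀ i, G (tgt i)),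
      z = ∑ i, coeff i • of (f i) (g i) := by
  let z' : (Σ c, (d ⟶ c) × G c) →₀ Λ := z
  let e := z'.support.equivFin
  refine ⟨_, fun i => z' (e.symm i), fun i => (e.symm i).1.1, fun i => (e.symm i).1.2.1,
    fun i => (e.symm i).1.2.2, ?_⟩
  rw [e.symm.sum_comp fun s => (z' s • of s.1.2.1 s.1.2.2 : (freePresheaf Λ G).obj (op d)),
    Finset.sum_coe_sort z'.support
      fun s => (z' s • of s.2.1 s.2.2 : (freePresheaf Λ G).obj (op d))]
  refine (Finsupp.sum_single z').symm.trans (Finset.sum_congr rfl fun s _ => ?_)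
  exact ((Finsupp.smul_single ..).trans (by simp)).symm

/-- The functoriality of the free presheaf in the family of generators. -/
noncomputable def map (φ : ∀ c, G c → H c) : freePresheaf Λ G ⟶ freePresheaf Λ H :=
  desc fun c g => of (𝟙 c) (φ c g)

lemma map_app_of (φ : ∀ c, G c → H c) {d c : C} (f : d ⟶ c) (g : G c) :
    (map (Λ := Λ) φ).app (op d) (of f g) = of f (φ c g) := by
  rw [map, desc_of, map_of, Category.comp_id]

lemma map_app_injective (φ : ∀ c, G c → H c) (hφ : ∀ c, Function.Injective (φ c)) (d : C) :
    Function.Injective ((map (Λ := Λ) φ).app (op d)) := by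
  let σ : (Σ c, (d ⟶ c) × G c) → Σ c, (d ⟶ c) × H c := fun s => ⟨s.1, s.2.1, φ _ s.2.2⟩
  have hσ : Function.Injective σ := by
    rintro ⟨c, f, g⟩ ⟨c', f', g'⟩ h
    obtain ⟨hc, h⟩ := Sigma.mk.inj h
    dsimp only at hc
    subst hc
    obtain ⟨hf, hg⟩ := Prod.mk.inj (eq_of_heq h)
    exact congrArg₂ (fun f g => (⟨c, f, g⟩ : Σ c, (d ⟶ c) × G c)) hf (hφ _ hg)
  have : (map (Λ := Λ) φ).app (op d) = ModuleCat.ofHom (Finsupp.lmapDomain Λ Λ σ) := by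
    refine ModuleCat.hom_ext (Finsupp.lhom_ext' fun ⟨c, f, g⟩ => LinearMap.ext_ring ?_)
    refine (map_app_of φ f g).trans (.symm ?_)
    exact Finsupp.mapDomain_single
  rw [this]
  exact Finsupp.mapDomain_injective hσ

lemma desc_sum (a : ∀ c, G c → M.obj (op c)) {d : C} {k : ℕ} (coeff : Fin k → Λ)
    {tgt : Fin k → C} (f : ∀ i, d ⟶ tgt i) (g : ∀ i, G (tgt i)) :
    (desc (Λ := Λ) a).app (op d) (∑ i, coeff i • of (f i) (g i)) =
      ∑ i, coeff i • M.map (f i).op (a (tgt i) (g i)) := by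
  simp only [map_sum, map_smul, desc_of]

lemma map_app_sum (φ : ∀ c, G c → H c) {d : C} {k : ℕ} (coeff : Fin k → Λ)
    {tgt : Fin k → C} (f : ∀ i, d ⟶ tgt i) (g : ∀ i, G (tgt i)) :
    (map (Λ := Λ) φ).app (op d) (∑ i, coeff i • of (f i) (g i)) =
      ∑ i, coeff i • of (f i) (φ _ (g i)) := by
  simp only [map_sum, map_smul, map_app_of]

/-- Two morphisms that agree on the generators occurring in a linear combination agree on it. -/
lemma app_sum_congr {α β : freePresheaf Λ G ⟶ M} {d : C} {k : ℕ} (coeff : Fin k → Λ)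
    {tgt : Fin k → C} (f : ∀ i, d ⟶ tgt i) {g : ∀ i, G (tgt i)}
    (h : ∀ i, α.app (op (tgt i)) (of (𝟙 _) (g i)) = β.app (op (tgt i)) (of (𝟙 _) (g i))) :
    α.app (op d) (∑ i, coeff i • of (f i) (g i)) =
      β.app (op d) (∑ i, coeff i • of (f i) (g i)) := by
  simp only [map_sum, map_smul, app_of _ (f _), h]

end freePresheaf

namespace representablePresheaf

variable {c : C} {M : Cᵒᵖ ⥤ ModuleCat.{u} Λ}

/-- The section over `d` of the representable presheaf of `c` given by a morphism `d ⟶ c`. -/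
noncomputable def of {d : C} (f : d ⟶ c) : (representablePresheaf Λ c).obj (op d) :=
  ModuleCat.freeMk f

lemma map_of {e d : C} (φ : e ⟶ d) (f : d ⟶ c) :
    (representablePresheaf Λ c).map φ.op (of f) = of (φ ≫ f) :=
  ModuleCat.free_map_apply _ _

lemma app_of (α : representablePresheaf Λ c ⟶ M) {d : C} (f : d ⟶ c) :
    α.app (op d) (of f) = M.map f.op (α.app (op c) (of (𝟙 c))) := by
  rw [← NatTrans.naturality_apply, map_of, Category.comp_id]

lemma hom_ext {α β : representablePresheaf Λ c ⟶ M}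
    (h : α.app (op c) (of (𝟙 c)) = β.app (op c) (of (𝟙 c))) : α = β := by
  ext d : 2
  refine ModuleCat.free_hom_ext fun f => ?_
  change α.app (op d.unop) (of f) = β.app (op d.unop) (of f)
  rw [app_of α, app_of β, h]

end representablePresheaf

namespace freePresheaf

variable {G : C → Type u}

/-- The inclusion of the representable presheaf corresponding to one generator. -/
noncomputable def ι {c : C} (g : G c) : representablePresheaf Λ c ⟶ freePresheaf Λ G where
  app d := ModuleCat.freeDesc (↾fun f : d.unop ⟶ c => of f g)
  naturality d e φ := by
    refine ModuleCat.free_hom_ext fun f => ?_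
    refine (congrArg (ModuleCat.freeDesc _)
      (representablePresheaf.map_of (Λ := Λ) φ.unop f)).trans ?_
    refine (ModuleCat.freeDesc_apply _ _).trans ((map_of φ.unop f g).symm.trans ?_)
    exact congrArg _ (ModuleCat.freeDesc_apply (↾fun f : d.unop ⟶ c => of f g) f).symm

lemma ι_app_of {d c : C} (f : d ⟶ c) (g : G c) :
    (ι (Λ := Λ) g).app (op d) (representablePresheaf.of f) = of f g :=
  ModuleCat.freeDesc_apply _ _

/-- A free presheaf is the coproduct of the representables given by its generators. -/
noncomputable def isColimit (Λ : Type u) [CommRing Λ] (G : C → Type u) :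
    IsColimit (Cofan.mk (freePresheaf Λ G) fun s : Σ c, G c => ι s.2) :=
  Cofan.IsColimit.mk _
    (fun t => desc fun c g => (t.inj ⟨c, g⟩).app (op c) (representablePresheaf.of (𝟙 c)))
    (fun t s => representablePresheaf.hom_ext <|
      (congrArg ((desc _).app _) (ι_app_of (𝟙 s.1) s.2)).trans
        (desc_of_id (fun c g => (t.inj ⟨c, g⟩).app (op c) (representablePresheaf.of (𝟙 c))) s.2))
    (fun t m hm => hom_ext fun c g => by
      rw [desc_of_id, ← hm ⟨c, g⟩, ← ι_app_of]
      rfl)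

lemma isSemiRepresentable (G : C → Type u) : IsSemiRepresentable (freePresheaf Λ G) :=
  ⟨Σ c, G c, Sigma.fst, ⟨(isColimit Λ G).coconePointUniqueUpToIso (coproductIsCoproduct _)⟩⟩

end freePresheaf

/-! ### Differentials and components of presheaves of complexes -/

open freePresheaf

namespace ComplexPresheaf

/-- The differential of a presheaf of complexes, as a morphism of presheaves of modules. -/
def degreeD (K : ComplexPresheaf C Λ) (i j : ℤ) : K.degree i ⟶ K.degree j where
  app c := (K.obj c).d i j
  naturality _ _ f := (K.map f).comm i j

/-- The component in degree `n` of a morphism, as a morphism of presheaves of modules. -/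
abbrev degreeMap {K L : ComplexPresheaf C Λ} (φ : K ⟶ L) (n : ℤ) : K.degree n ⟶ L.degree n :=
  Functor.whiskerRight φ (HomologicalComplex.eval (ModuleCat.{u} Λ) (ComplexShape.down ℤ) n)

lemma degreeD_comp_degreeMap {K L : ComplexPresheaf C Λ} (φ : K ⟶ L) (i j : ℤ) :
    K.degreeD i j ≫ degreeMap φ j = degreeMap φ i ≫ L.degreeD i j := by
  ext c : 2
  exact ((φ.app c).comm i j).symm

/-! ### Cells -/

variable (K L N : ComplexPresheaf C Λ)

/-- Formal cells of degree `n` over the object `c`. A formal cell records a section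
`value` of `K` in degree `n` over `c`, and a formal linear combination of restrictions along
morphisms `f i : c ⟶ tgt i` of formal cells `face i` of degree `n - 1`; the degree `n - 1` is
encoded as an integer `j` with `j + 1 = n`. Nothing requires yet that the linear combination be a
cycle, nor that its image in `K` be the boundary of the value; see `PreCell.Valid`. -/
inductive PreCell : ℤ → C → Type u
  | mk {n : ℤ} {c : C} (k : ℕ) (coeff : Fin k → Λ) (tgt : Fin k → C) (f : ∀ i, c ⟶ tgt i)
      (face : ∀ j : ℤ, j + 1 = n → ∀ i, PreCell j (tgt i)) (value : (K.degree n).obj (op c)) :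
      PreCell n c

variable {K L N}

namespace PreCell

/-- The section of `K` recorded by a formal cell. -/
def value {n : ℤ} {c : C} : PreCell K n c → (K.degree n).obj (op c)
  | mk _ _ _ _ _ x => x

/-- The formal linear combination of formal cells recorded by a formal cell. -/
noncomputable def boundary {n : ℤ} {c : C} :
    PreCell K n c → ∀ j : ℤ, j + 1 = n → (freePresheaf Λ (PreCell K j)).obj (op c)
  | mk _ coeff _ f face _, j, h => ∑ i, coeff i • of (f i) (face j h i)

/-- The linear extension of `PreCell.boundary`. -/
noncomputable def boundaryHom (K : ComplexPresheaf C Λ) {n j : ℤ} (h : j + 1 = n) :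
    freePresheaf Λ (PreCell K n) ⟶ freePresheaf Λ (PreCell K j) :=
  desc fun _ g => g.boundary j h

/-- The linear extension of `PreCell.value`. -/
noncomputable def valueHom (K : ComplexPresheaf C Λ) (n : ℤ) :
    freePresheaf Λ (PreCell K n) ⟶ K.degree n :=
  desc fun _ g => g.value

/-- A formal cell is valid if its faces are, its boundary is a cycle, and its boundary is sent to
the boundary of its value. -/
def Valid {n : ℤ} {c : C} : PreCell K n c → Prop
  | mk _ coeff _ f face x => ∀ (j : ℤ) (h : j + 1 = n), (∀ i, (face j h i).Valid) ∧
      (∀ (l : ℤ) (h' : l + 1 = j),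
        (boundaryHom K h').app (op c) (∑ i, coeff i • of (f i) (face j h i)) = 0) ∧
      (valueHom K j).app (op c) (∑ i, coeff i • of (f i) (face j h i)) =
        (K.degreeD n j).app (op c) x

/-- The functoriality of formal cells in the presheaf of complexes: only the values change. -/
def map (φ : K ⟶ L) {n : ℤ} {c : C} : PreCell K n c → PreCell L n c
  | mk k coeff tgt f face x => mk k coeff tgt f (fun j h i => (face j h i).map φ)
      ((degreeMap φ n).app (op c) x)

lemma map_id {n : ℤ} {c : C} (g : PreCell K n c) : g.map (𝟙 K) = g := by
  induction g with
  | mk k coeff tgt f face x ih =>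
    rw [map]
    congr 1
    funext j h i
    exact ih j h i

lemma map_comp (φ : K ⟶ L) (ψ : L ⟶ N) {n : ℤ} {c : C} (g : PreCell K n c) :
    g.map (φ ≫ ψ) = (g.map φ).map ψ := by
  induction g with
  | mk k coeff tgt f face x ih =>
    rw [map, map, map]
    congr 1
    funext j h i
    exact ih j h i

lemma value_map (φ : K ⟶ L) {n : ℤ} {c : C} (g : PreCell K n c) :
    (g.map φ).value = (degreeMap φ n).app (op c) g.value := by
  cases g
  rfl

lemma boundary_map (φ : K ⟶ L) {n j : ℤ} (h : j + 1 = n) {c : C} (g : PreCell K n c) :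
    (g.map φ).boundary j h =
      (freePresheaf.map fun _ => PreCell.map φ).app (op c) (g.boundary j h) := by
  cases g
  exact (map_app_sum ..).symm

lemma boundaryHom_of {n j : ℤ} (h : j + 1 = n) {c : C} (g : PreCell K n c) :
    (boundaryHom K h).app (op c) (of (𝟙 c) g) = g.boundary j h :=
  desc_of_id _ _

lemma valueHom_of {n : ℤ} {c : C} (g : PreCell K n c) :
    (valueHom K n).app (op c) (of (𝟙 c) g) = g.value :=
  desc_of_id _ _

lemma boundaryHom_naturality (φ : K ⟶ L) {n j : ℤ} (h : j + 1 = n) :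
    boundaryHom K h ≫ freePresheaf.map (fun _ => PreCell.map φ) =
      freePresheaf.map (fun _ => PreCell.map φ) ≫ boundaryHom L h := by
  refine freePresheaf.hom_ext fun c g => ?_
  rw [NatTrans.comp_app_apply, NatTrans.comp_app_apply, boundaryHom_of, map_app_of,
    boundaryHom_of, boundary_map]

lemma valueHom_naturality (φ : K ⟶ L) (n : ℤ) :
    valueHom K n ≫ degreeMap φ n =
      freePresheaf.map (fun _ => PreCell.map φ) ≫ valueHom L n := by
  refine freePresheaf.hom_ext fun c g => ?_
  rw [NatTrans.comp_app_apply, NatTrans.comp_app_apply, valueHom_of, map_app_of,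
    valueHom_of, value_map]

lemma Valid.map (φ : K ⟶ L) {n : ℤ} {c : C} {g : PreCell K n c} (hg : g.Valid) :
    (g.map φ).Valid := by
  induction g with
  | @mk n c k coeff tgt f face x ih =>
    intro j h
    obtain ⟨h₁, h₂, h₃⟩ := hg j h
    have key := map_app_sum (Λ := Λ) (fun c => PreCell.map (n := j) (c := c) φ) coeff f (face j h)
    refine ⟨fun i => ih j h i (h₁ i), fun l h' => ?_, ?_⟩
    · rw [← key, ← NatTrans.comp_app_apply,
        ← boundaryHom_naturality, NatTrans.comp_app_apply, h₂, map_zero]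
    · rw [← key, ← NatTrans.comp_app_apply,
        ← valueHom_naturality, NatTrans.comp_app_apply, h₃]
      exact ConcreteCategory.congr_hom (NatTrans.congr_app (degreeD_comp_degreeMap φ n j) (op c)) x

end PreCell

/-- The cells of degree `n` over `c`: the generators of the cofibrant replacement. -/
structure Cell (K : ComplexPresheaf C Λ) (n : ℤ) (c : C) : Type u where
  /-- The underlying formal cell. -/
  toPreCell : PreCell K n c
  valid : toPreCell.Valid

namespace Cell

/-- The morphism of free presheaves induced by the inclusion of cells into formal cells. -/
noncomputable def incl (K : ComplexPresheaf C Λ) (n : ℤ) :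
    freePresheaf Λ (Cell K n) ⟶ freePresheaf Λ (PreCell K n) :=
  freePresheaf.map fun _ => Cell.toPreCell

lemma incl_injective (n : ℤ) (c : C) :
    Function.Injective ((incl K n).app (op c)) :=
  map_app_injective _ (fun _ g g' h => by cases g; cases g'; congr) c

/-- The boundary of a cell, as a linear combination of cells. -/
noncomputable def boundary {n : ℤ} {c : C} :
    Cell K n c → ∀ j : ℤ, j + 1 = n → (freePresheaf Λ (Cell K j)).obj (op c)
  | ⟨.mk _ coeff _ f face _, hg⟩, j, h =>
    ∑ i, coeff i • of (f i) (⟨face j h i, (hg j h).1 i⟩ : Cell K j _)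

lemma incl_boundary {n : ℤ} {c : C} (g : Cell K n c) (j : ℤ) (h : j + 1 = n) :
    (incl K j).app (op c) (g.boundary j h) = g.toPreCell.boundary j h := by
  obtain ⟨⟨⟩, hg⟩ := g
  exact map_app_sum ..

/-- The linear extension of `Cell.boundary`. -/
noncomputable def boundaryHom (K : ComplexPresheaf C Λ) {n j : ℤ} (h : j + 1 = n) :
    freePresheaf Λ (Cell K n) ⟶ freePresheaf Λ (Cell K j) :=
  desc fun _ g => g.boundary j h

/-- The linear extension of the values of the cells. -/
noncomputable def valueHom (K : ComplexPresheaf C Λ) (n : ℤ) :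
    freePresheaf Λ (Cell K n) ⟶ K.degree n :=
  desc fun _ g => g.toPreCell.value

lemma boundaryHom_of {n j : ℤ} (h : j + 1 = n) {c : C} (g : Cell K n c) :
    (boundaryHom K h).app (op c) (of (𝟙 c) g) = g.boundary j h :=
  desc_of_id _ _

lemma valueHom_of {n : ℤ} {c : C} (g : Cell K n c) :
    (valueHom K n).app (op c) (of (𝟙 c) g) = g.toPreCell.value :=
  desc_of_id _ _

lemma incl_of {n : ℤ} {c : C} (g : Cell K n c) :
    (incl K n).app (op c) (of (𝟙 c) g) = of (𝟙 c) g.toPreCell :=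
  map_app_of ..

lemma boundaryHom_incl {n j : ℤ} (h : j + 1 = n) :
    boundaryHom K h ≫ incl K j = incl K n ≫ PreCell.boundaryHom K h := by
  refine freePresheaf.hom_ext fun c g => ?_
  rw [NatTrans.comp_app_apply, NatTrans.comp_app_apply, boundaryHom_of, incl_boundary, incl_of,
    PreCell.boundaryHom_of]

lemma incl_valueHom (n : ℤ) : incl K n ≫ PreCell.valueHom K n = valueHom K n := by
  refine freePresheaf.hom_ext fun c g => ?_
  rw [NatTrans.comp_app_apply, incl_of, PreCell.valueHom_of, valueHom_of]

lemma boundaryHom_boundary {n j l : ℤ} (h : j + 1 = n) (h' : l + 1 = j) {c : C}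
    (g : Cell K n c) : (boundaryHom K h').app (op c) (g.boundary j h) = 0 := by
  apply incl_injective
  rw [← NatTrans.comp_app_apply, boundaryHom_incl, NatTrans.comp_app_apply,
    incl_boundary, map_zero]
  obtain ⟨⟨⟩, hg⟩ := g
  exact (hg j h).2.1 l h'

lemma valueHom_boundary {n j : ℤ} (h : j + 1 = n) {c : C} (g : Cell K n c) :
    (valueHom K j).app (op c) (g.boundary j h) = (K.degreeD n j).app (op c) g.toPreCell.value := by
  rw [← incl_valueHom, NatTrans.comp_app_apply, incl_boundary]
  obtain ⟨⟨⟩, hg⟩ := g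
  exact (hg j h).2.2

lemma boundaryHom_comp {n j l : ℤ} (h : j + 1 = n) (h' : l + 1 = j) :
    boundaryHom K h ≫ boundaryHom K h' = 0 := by
  refine freePresheaf.hom_ext fun c g => ?_
  rw [NatTrans.comp_app_apply, boundaryHom_of, boundaryHom_boundary]
  rfl

lemma boundaryHom_comp_valueHom {n j : ℤ} (h : j + 1 = n) :
    boundaryHom K h ≫ valueHom K j = valueHom K n ≫ K.degreeD n j := by
  refine freePresheaf.hom_ext fun c g => ?_
  rw [NatTrans.comp_app_apply, NatTrans.comp_app_apply, boundaryHom_of, valueHom_boundary,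
    valueHom_of]

/-- The defining property of the cells: every cycle `z` in degree `j` together with a section `y`
of `K` whose boundary is the image of `z` comes from a cell. -/
lemma exists_boundary_eq {n j : ℤ} (h : j + 1 = n) {c : C}
    (z : (freePresheaf Λ (Cell K j)).obj (op c)) (y : (K.degree n).obj (op c))
    (hz : ∀ (l : ℤ) (h' : l + 1 = j), (boundaryHom K h').app (op c) z = 0)
    (hy : (valueHom K j).app (op c) z = (K.degreeD n j).app (op c) y) :
    ∃ g : Cell K n c, g.boundary j h = z ∧ g.toPreCell.value = y := by
  obtain ⟨k, coeff, tgt, f, face, rfl⟩ := exists_eq_sum z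
  obtain rfl : j = n - 1 := by omega
  have cast (j : ℤ) (hj : j + 1 = n) : n - 1 = j := by omega
  refine ⟨⟨.mk k coeff tgt f (fun j hj i => cast j hj ▸ (face i).toPreCell) y, ?_⟩, ?_, ?_⟩
  · intro j hj
    obtain rfl := cast j hj
    have key : ∑ i, coeff i • of (f i) (face i).toPreCell = (incl K (n - 1)).app (op c)
      (∑ i, coeff i • of (f i) (face i)) := (map_app_sum ..).symm
    dsimp only
    rw [key]
    refine ⟨fun i => (face i).valid, fun l h' => ?_, ?_⟩
    · rw [← NatTrans.comp_app_apply, ← boundaryHom_incl, NatTrans.comp_app_apply, hz,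
        map_zero]
    · rw [← NatTrans.comp_app_apply, incl_valueHom, hy]
  · rfl
  · rfl

/-- The functoriality of cells in the presheaf of complexes. -/
def map (φ : K ⟶ L) {n : ℤ} {c : C} (g : Cell K n c) : Cell L n c :=
  ⟨g.toPreCell.map φ, g.valid.map φ⟩

lemma map_id {n : ℤ} {c : C} (g : Cell K n c) : g.map (𝟙 K) = g := by
  cases g
  simp only [map, PreCell.map_id]

lemma map_comp (φ : K ⟶ L) (ψ : L ⟶ N) {n : ℤ} {c : C} (g : Cell K n c) :
    g.map (φ ≫ ψ) = (g.map φ).map ψ := by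
  simp only [map, PreCell.map_comp]

lemma boundary_map (φ : K ⟶ L) {n j : ℤ} (h : j + 1 = n) {c : C} (g : Cell K n c) :
    (g.map φ).boundary j h =
      (freePresheaf.map fun d => Cell.map (n := j) (c := d) φ).app (op c) (g.boundary j h) := by
  obtain ⟨⟨k, coeff, tgt, f, face, x⟩, hg⟩ := g
  refine Eq.trans ?_ (map_app_sum (Λ := Λ) (fun d => Cell.map (n := j) (c := d) φ) coeff f
    fun i => ⟨face j h i, (hg j h).1 i⟩).symm
  rfl

lemma boundaryHom_naturality (φ : K ⟶ L) {n j : ℤ} (h : j + 1 = n) :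
    freePresheaf.map (fun _ => Cell.map φ) ≫ boundaryHom L h =
      boundaryHom K h ≫ freePresheaf.map (fun _ => Cell.map φ) := by
  refine freePresheaf.hom_ext fun c g => ?_
  rw [NatTrans.comp_app_apply, NatTrans.comp_app_apply, map_app_of, boundaryHom_of,
    boundaryHom_of, boundary_map]

lemma valueHom_naturality (φ : K ⟶ L) (n : ℤ) :
    freePresheaf.map (fun _ => Cell.map φ) ≫ valueHom L n = valueHom K n ≫ degreeMap φ n := by
  refine freePresheaf.hom_ext fun c g => ?_
  rw [NatTrans.comp_app_apply, NatTrans.comp_app_apply, map_app_of, valueHom_of, valueHom_of]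
  exact PreCell.value_map φ g.toPreCell

end Cell

/-! ### The cellular replacement -/

variable {X Y : ComplexPresheaf C Λ}

/-- The complex of free presheaves on the cells of `K`. -/
noncomputable def cellComplex (K : ComplexPresheaf C Λ) :
    ChainComplex (Cᵒᵖ ⥤ ModuleCat.{u} Λ) ℤ where
  X n := freePresheaf Λ (Cell K n)
  d n j := if h : j + 1 = n then Cell.boundaryHom K h else 0
  shape _ _ h := dif_neg h
  d_comp_d' n j l h h' := by
    rw [dif_pos (show j + 1 = n from h), dif_pos (show l + 1 = j from h'), Cell.boundaryHom_comp]

lemma cellComplex_d {n j : ℤ} (h : j + 1 = n) :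
    (cellComplex K).d n j = Cell.boundaryHom K h := dif_pos h

/-- The functoriality of the complex of free presheaves on the cells. -/
noncomputable def cellComplexFunctor (C : Type u) [SmallCategory C] (Λ : Type u) [CommRing Λ] :
    ComplexPresheaf C Λ ⥤ ChainComplex (Cᵒᵖ ⥤ ModuleCat.{u} Λ) ℤ where
  obj K := cellComplex K
  map φ :=
    { f n := freePresheaf.map fun _ => Cell.map φ
      comm' n j h := by
        rw [cellComplex_d h, cellComplex_d h]
        exact Cell.boundaryHom_naturality φ h }
  map_id K := by
    ext n : 1
    refine freePresheaf.hom_ext fun c g => (map_app_of _ _ _).trans ?_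
    rw [Cell.map_id]
    rfl
  map_comp φ ψ := by
    ext n : 1
    refine freePresheaf.hom_ext fun c g => (map_app_of _ _ _).trans ?_
    rw [Cell.map_comp]
    refine .symm ((congrArg ((freePresheaf.map fun _ => Cell.map ψ).app (op c))
      (map_app_of _ _ _)).trans (map_app_of _ _ _))

/-- The cofibrant replacement functor: the presheaf of complexes of free presheaves on cells. -/
noncomputable def cellReplacement (C : Type u) [SmallCategory C] (Λ : Type u) [CommRing Λ] :
    ComplexPresheaf C Λ ⥤ ComplexPresheaf C Λ :=
  cellComplexFunctor C Λ ⋙ HomologicalComplex.complexOfFunctorsToFunctorToComplex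

/-- The augmentation of the cofibrant replacement, sending each cell to its value. -/
noncomputable def cellReplacementπ (C : Type u) [SmallCategory C] (Λ : Type u) [CommRing Λ] :
    cellReplacement C Λ ⟶ 𝟭 (ComplexPresheaf C Λ) where
  app K :=
    { app c :=
        { f n := (Cell.valueHom K n).app c
          comm' n j h := by
            change _ = ((cellComplex K).d n j).app c ≫ _
            rw [cellComplex_d h]
            exact (NatTrans.congr_app (Cell.boundaryHom_comp_valueHom h) c).symm }
      naturality c d f := by
        ext n : 1
        exact (Cell.valueHom K n).naturality f }
  naturality K L φ := by
    ext c n : 3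
    exact NatTrans.congr_app (Cell.valueHom_naturality φ n) c

lemma trivialFibrations_iff (p : X ⟶ Y) :
    trivialFibrations (ComplexPresheaf C Λ) p ↔ ∀ c, ChainComplex.LiftsDisks (p.app c) := by
  constructor
  · rintro ⟨h₁, h₂⟩ c
    have := h₂ c
    exact ChainComplex.liftsDisks_of_quasiIso _ (h₁ c)
  · exact fun h => ⟨fun c => (h c).surjective, fun c => (h c).quasiIso⟩

lemma trivialFibrations_cellReplacementπ (K : ComplexPresheaf C Λ) :
    trivialFibrations (ComplexPresheaf C Λ) ((cellReplacementπ C Λ).app K) := by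
  rw [trivialFibrations_iff]
  intro c n j h z y hz hy
  obtain ⟨g, rfl, rfl⟩ := Cell.exists_boundary_eq (c := c.unop) h z y
    (fun l h' => by rw [← cellComplex_d]; exact hz l h') hy
  refine ⟨of (𝟙 c.unop) g, ?_, Cell.valueHom_of g⟩
  change ((cellComplex K).d n j).app (op c.unop) _ = _
  rw [cellComplex_d h]
  exact Cell.boundaryHom_of h g

/-! ### Lifting along trivial fibrations -/

namespace Cell

section Lift

variable (p : X ⟶ Y) (v : ∀ n, freePresheaf Λ (Cell K n) ⟶ Y.degree n)

open Classical in
/-- The values on the cells of a lift to `X` of a morphism `v` from the cellular replacement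
of `K` to `Y`. By recursion, the value at a cell is a section of `X` whose boundary is
the combination of the values at the faces, and whose image in `Y` is prescribed by `v`; the
junk value `0` does not occur when `p` is a trivial fibration. -/
noncomputable def liftAux {n : ℤ} {c : C} : ∀ g : PreCell K n c, g.Valid → (X.degree n).obj (op c)
  | .mk k coeff tgt f face x, hg =>
    if h : ∃ y : (X.degree n).obj (op c),
        (∀ (j : ℤ) (h : j + 1 = n), (X.degreeD n j).app (op c) y =
          ∑ i, coeff i • (X.degree j).map (f i).op (liftAux (face j h i) ((hg j h).1 i))) ∧
        (degreeMap p n).app (op c) y =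
          (v n).app (op c) (of (𝟙 c) (⟨.mk k coeff tgt f face x, hg⟩ : Cell K n c))
    then h.choose else 0

/-- The linear extension of `Cell.liftAux`. -/
noncomputable def lift (n : ℤ) : freePresheaf Λ (Cell K n) ⟶ X.degree n :=
  desc fun _ g => liftAux p v g.toPreCell g.valid

lemma lift_of {n : ℤ} {c : C} (g : Cell K n c) :
    (lift p v n).app (op c) (of (𝟙 c) g) = liftAux p v g.toPreCell g.valid :=
  desc_of_id _ _

variable {p v}

/-- The recursion defining `Cell.liftAux` never fails along a trivial fibration: the combination
of the values at the faces is a cycle lying over the boundary of the prescribed image. -/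
lemma liftAux_spec (hp : trivialFibrations (ComplexPresheaf C Λ) p)
    (hv : ∀ {n j : ℤ} (h : j + 1 = n), boundaryHom K h ≫ v j = v n ≫ Y.degreeD n j)
    {n : ℤ} {c : C} (g : PreCell K n c) (hg : g.Valid) :
    (∀ (j : ℤ) (h : j + 1 = n), (X.degreeD n j).app (op c) (liftAux p v g hg) =
      (lift p v j).app (op c) ((⟨g, hg⟩ : Cell K n c).boundary j h)) ∧
    (degreeMap p n).app (op c) (liftAux p v g hg) =
      (v n).app (op c) (of (𝟙 c) (⟨g, hg⟩ : Cell K n c)) := by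
  induction g with
  | @mk n c k coeff tgt f face x ih =>
    have hsum (j : ℤ) (h : j + 1 = n) :
        (lift p v j).app (op c) ((⟨_, hg⟩ : Cell K n c).boundary j h) =
          ∑ i, coeff i • (X.degree j).map (f i).op (liftAux p v (face j h i) ((hg j h).1 i)) :=
      desc_sum _ coeff f fun i => (⟨face j h i, (hg j h).1 i⟩ : Cell K j _)
    suffices h : ∃ y : (X.degree n).obj (op c),
        (∀ (j : ℤ) (h : j + 1 = n), (X.degreeD n j).app (op c) y =
          ∑ i, coeff i • (X.degree j).map (f i).op (liftAux p v (face j h i) ((hg j h).1 i))) ∧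
        (degreeMap p n).app (op c) y =
          (v n).app (op c) (of (𝟙 c) (⟨.mk k coeff tgt f face x, hg⟩ : Cell K n c)) by
      have e : liftAux p v _ hg = h.choose := dif_pos h
      rw [e]
      exact ⟨fun j hj => (h.choose_spec.1 j hj).trans (hsum j hj).symm, h.choose_spec.2⟩
    have hn : n - 1 + 1 = n := sub_add_cancel n 1
    obtain ⟨y, hy, hy'⟩ := (trivialFibrations_iff p).1 hp (op c) hn
      ((lift p v (n - 1)).app (op c) ((⟨_, hg⟩ : Cell K n c).boundary (n - 1) hn))
      ((v n).app (op c) (of (𝟙 c) (⟨_, hg⟩ : Cell K n c))) (fun l hl => by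
        -- the inductive hypothesis reduces this to the boundary of the boundary being zero
        refine (app_sum_congr (α := lift p v (n - 1) ≫ X.degreeD (n - 1) l)
          (β := boundaryHom K hl ≫ lift p v l) coeff f fun i => ?_).trans ?_
        · rw [NatTrans.comp_app_apply, NatTrans.comp_app_apply, lift_of, boundaryHom_of]
          exact (ih _ hn i _).1 l hl
        · exact (congrArg ((lift p v l).app (op c)) (boundaryHom_boundary hn hl ⟨_, hg⟩)).trans
            (map_zero _)) (by
        refine (app_sum_congr (α := lift p v (n - 1) ≫ degreeMap p (n - 1))
          (β := v (n - 1)) coeff f fun i => ?_).trans ?_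
        · rw [NatTrans.comp_app_apply, lift_of]
          exact (ih _ hn i _).2
        · have := ConcreteCategory.congr_hom (NatTrans.congr_app (hv hn) (op c))
            (of (𝟙 c) (⟨_, hg⟩ : Cell K n c))
          rw [NatTrans.comp_app_apply, boundaryHom_of] at this
          exact this)
    refine ⟨y, fun j h => ?_, hy'⟩
    obtain rfl : j = n - 1 := by omega
    exact hy.trans (hsum _ h)

lemma lift_comp_degreeD (hp : trivialFibrations (ComplexPresheaf C Λ) p)
    (hv : ∀ {n j : ℤ} (h : j + 1 = n), boundaryHom K h ≫ v j = v n ≫ Y.degreeD n j)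
    {n j : ℤ} (h : j + 1 = n) :
    lift p v n ≫ X.degreeD n j = boundaryHom K h ≫ lift p v j := by
  refine freePresheaf.hom_ext fun c g => ?_
  rw [NatTrans.comp_app_apply, NatTrans.comp_app_apply, lift_of, boundaryHom_of]
  exact (liftAux_spec hp hv g.toPreCell g.valid).1 j h

lemma lift_comp_degreeMap (hp : trivialFibrations (ComplexPresheaf C Λ) p)
    (hv : ∀ {n j : ℤ} (h : j + 1 = n), boundaryHom K h ≫ v j = v n ≫ Y.degreeD n j) (n : ℤ) :
    lift p v n ≫ degreeMap p n = v n := by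
  refine freePresheaf.hom_ext fun c g => ?_
  rw [NatTrans.comp_app_apply, lift_of]
  exact (liftAux_spec hp hv g.toPreCell g.valid).2

end Lift

end Cell

lemma isCofibrant_cellReplacement (K : ComplexPresheaf C Λ) :
    IsCofibrant ((cellReplacement C Λ).obj K) := by
  refine ⟨fun X Y p hp => ⟨fun {t b} sq => ?_⟩⟩
  let v (n : ℤ) : freePresheaf Λ (Cell K n) ⟶ Y.degree n := degreeMap b n
  have hv {n j : ℤ} (h : j + 1 = n) : Cell.boundaryHom K h ≫ v j = v n ≫ Y.degreeD n j := by
    rw [← cellComplex_d h]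
    exact degreeD_comp_degreeMap b n j
  let l : (cellReplacement C Λ).obj K ⟶ X :=
    { app c :=
        { f n := (Cell.lift p v n).app c
          comm' n j h := by
            change _ = ((cellComplex K).d n j).app c ≫ _
            rw [cellComplex_d h]
            exact NatTrans.congr_app (Cell.lift_comp_degreeD hp hv h) c }
      naturality c d f := by
        ext n : 1
        exact (Cell.lift p v n).naturality f }
  exact ⟨⟨{ l := l
            fac_left := Subsingleton.elim _ _
            fac_right := by
              ext c n : 3
              exact NatTrans.congr_app (Cell.lift_comp_degreeMap hp hv n) c }⟩⟩

lemma isComplexOfSemiRepresentables_cellReplacement (K : ComplexPresheaf C Λ) :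
    ((cellReplacement C Λ).obj K).IsComplexOfSemiRepresentables := fun n =>
  freePresheaf.isSemiRepresentable (Cell K n)

end ComplexPresheaf

theorem mainTheorem5 (C : Type u) [SmallCategory C] (Λ : Type u) [CommRing Λ] :
    ∃ (Q : ComplexPresheaf C Λ ⥤ ComplexPresheaf C Λ) (q : Q ⟶ 𝟭 (ComplexPresheaf C Λ)),
      (∀ K : ComplexPresheaf C Λ, trivialFibrations (ComplexPresheaf C Λ) (q.app K)) ∧
      (∀ K : ComplexPresheaf C Λ,
        IsCofibrant (Q.obj K) ∧ (Q.obj K).IsComplexOfSemiRepresentables) ∧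
      IsCofibrantReplacementFunctor Q q :=
  ⟨ComplexPresheaf.cellReplacement C Λ, ComplexPresheaf.cellReplacementπ C Λ,
    ComplexPresheaf.trivialFibrations_cellReplacementπ,
    fun K => ⟨ComplexPresheaf.isCofibrant_cellReplacement K,
      ComplexPresheaf.isComplexOfSemiRepresentables_cellReplacement K⟩,
    fun K => ⟨ComplexPresheaf.isCofibrant_cellReplacement K,
      ComplexPresheaf.trivialFibrations_cellReplacementπ K⟩⟩
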